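/- Fix a service rate $\mu\in(0,1]$ and a weight $\lambda\in(0,\infty)$. Consider the Markov decision process with countable state space $\mathcal S=\{(a,z): a\in\{1,2,\dots\},\ z\in\{0,1,2,\dots\}\}$ ($a$ is the age at the monitor, $z$ is the service the current update has received at the local server) and actions $u\in\{0,1\}$ ($u=1$: send a fresh update to the mobile edge cloud (MEC); $u=0$: continue local service). From state $(a,z)$ the next state is $(1,0)$ with probability $1$ if $u=1$; if $u=0$ it is $(z+1,0)$ with probability $\mu$ and $(a+1,z+1)$ with probability $1-\mu$. The cost of action $u$ in state $(a,z)$ is $C((a,z),u)=a+\tfrac12+\lambda u$. A policy is a sequence $f=(f_n)_{n\ge0}$ of maps $f_n:\mathcal S\to\{0,1\}$, with the action $U_n=f_n(S_n)$ taken in slot $n$, and its long-run average cost from initial state $s$ is $$V_f(s)=\limsup_{N\to\infty}\frac1N\,\mathbb E_f\Bigl[\sum_{n=1}^N C(S_n,U_n)\,\Big|\,S_0=s\Bigr].$$ A $z$-dependent age threshold policy is a stationary deterministic policy (all $f_n$ equal to one map $\varphi:\mathcal S\to\{0,1\}$) such that $\varphi(a,z)=1$ implies $\varphi(a+1,z)=1$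 for all $(a,z)\in\mathcal S$. Theorem. There exists a $z$-dependent age threshold policy $f^*$ that minimizes the long-run average cost: $V_{f^*}(s)\le V_f(s)$ for every policy $f$ and every initial state $s\in\mathcal S$. -/

import Mathlib

open MeasureTheory ProbabilityTheory Filter

noncomputable section

namespace MECOffloading

/-- A state `(a, z)`: the age `a ∈ {1, 2, …}` at the monitor and the amount of service
`z ∈ {0, 1, …}` that the current update has received at the local server. -/
@[ext]
structure State where
  age : ℕ+
  service : ℕ

/-- The two actions: send a fresh update to the MEC (`u = 1`), or let the local server process the
last update (`u = 0`). -/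
inductive Action where
  | mec
  | localServer

instance : MeasurableSpace State := ⊤

instance : DiscreteMeasurableSpace State := ⟨fun _ => trivial⟩

instance : Countable State :=
  Function.Injective.countable (f := fun s : State => (s.age, s.service)) fun s t h => by
    simp only [Prod.mk.injEq] at h
    exact State.ext h.1 h.2

/-- The law of the next state. Under `mec` it is `(1, 0)` with probability one; under `localServer`
it is `(z + 1, 0)` with probability `μ` and `(a + 1, z + 1)` with probability `1 - μ`. -/
def transition (μ : unitInterval) (s : State) : Action → Measure State
  | .mec => Measure.dirac ⟨1, 0⟩
  | .localServer => bernoulliMeasure ⟨s.service.succPNat, 0⟩ ⟨s.age + 1, s.service + 1⟩ μ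

instance (μ : unitInterval) (s : State) (u : Action) :
    IsProbabilityMeasure (transition μ s u) := by
  cases u <;> unfold transition <;> infer_instance

/-- The indicator of the use of the MEC. -/
def mecUse : Action → ℝ
  | .mec => 1
  | .localServer => 0

/-- The cost of taking action `u` in state `s = (a, z)`: `a + 1/2 + lam * 1{u = mec}`. -/
def cost (lam : ℝ) (s : State) (u : Action) : ℝ :=
  ((s.age : ℕ) : ℝ) + 1 / 2 + lam * mecUse u

/-- A policy: a sequence of maps from states to actions; `f n` is used in slot `n`. -/
abbrev Policy := ℕ → State → Action

/-- The transition kernel of the state process from slot `n` to slot `n + 1` under the policy `f`,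
as a function of the states `S₀, …, Sₙ`; it only depends on `Sₙ`. -/
def stepKernel (μ : unitInterval) (f : Policy) (n : ℕ) :
    Kernel ((i : Finset.Iic n) → (fun _ : ℕ => State) i) State :=
  (Kernel.ofFunOfCountable fun s : State => transition μ s (f n s)).comap
    (fun x => x ⟨n, Finset.mem_Iic.2 le_rfl⟩) (measurable_pi_apply _)

instance (μ : unitInterval) (f : Policy) (n : ℕ) : IsMarkovKernel (stepKernel μ f n) :=
  ⟨fun x => by
    rw [stepKernel, Kernel.comap_apply]
    exact inferInstanceAs (IsProbabilityMeasure (transition μ _ (f n _)))⟩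

/-- The law of the trajectory `(S₀, S₁, S₂, …)` of the state process under the policy `f`, given
`S₀ = s`. -/
def trajectoryLaw (μ : unitInterval) (f : Policy) (s : State) : Measure (ℕ → State) :=
  Kernel.traj (X := fun _ => State) (stepKernel μ f) 0 (fun _ => s)

/-- `E_f [∑_{n = 1}^N C(Sₙ, Uₙ) | S₀ = s]` with `Uₙ = fₙ(Sₙ)`. -/
def expectedTotalCost (μ : unitInterval) (lam : ℝ) (f : Policy) (s : State) (N : ℕ) : ℝ :=
  ∫ S, ∑ n ∈ Finset.Icc 1 N, cost lam (S n) (f n (S n)) ∂(trajectoryLaw μ f s)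

/-- The long-run average cost `V_f(s)`, an upper limit in the extended reals. -/
def averageCost (μ : unitInterval) (lam : ℝ) (f : Policy) (s : State) : EReal :=
  limsup (fun N : ℕ => ((1 / (N : ℝ) * expectedTotalCost μ lam f s N : ℝ) : EReal)) atTop

/-- `f` minimizes the long-run average cost among all policies, from every initial state. -/
def IsAverageOptimal (μ : unitInterval) (lam : ℝ) (f : Policy) : Prop :=
  ∀ (g : Policy) (s : State), averageCost μ lam f s ≤ averageCost μ lam g s

/-- A stationary (deterministic) policy: the same map from states to actions in every slot. -/
def IsStationary (f : Policy) : Prop :=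
  ∃ φ : State → Action, ∀ n, f n = φ

/-- A `z`-dependent age threshold policy: a stationary deterministic policy which uses the MEC in
`(a + 1, z)` whenever it uses the MEC in `(a, z)`. -/
def IsAgeThreshold (f : Policy) : Prop :=
  IsStationary f ∧
    ∀ (n : ℕ) (a : ℕ+) (z : ℕ), f n ⟨a, z⟩ = .mec → f n ⟨a + 1, z⟩ = .mec

end MECOffloading

end

noncomputable section

namespace MECOffloading

/-! The plan is to solve the average-cost optimality equation `g + V s = min_u (cost + mean of V at
the next state)` with `V (1,0) = 0` and `V` nondecreasing in the age. Without killing, constants are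
preserved by the transitions, so no weighted contraction is available. Every `mec` action leads to
`(1,0)`, and local service returns there with probability `p` from `z = 0`; killing the process at
`(1,0)` therefore gives a contraction in a weighted sup norm (`exists_isContractingWeight`). Value
iteration then converges for each `g`, and its limit inherits monotonicity in the age
(`exists_tendsto_iterate`). The limit at `(1,0)` is continuous in `g` and changes sign, so some `g`
makes it zero (`exists_isKilledValue_eq_zero`). For this `g` the killing is invisible and `V` solves
the original equation. The same weight has uniformly bounded mean under every policy. Telescoping
the equation thus bounds the total cost below by `N * g + O(1)` for every policy, and above for the
greedy one. The greedy policy sends when `killedMean` of `V` reaches `lam`, a condition that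
persists as the age grows. -/

/-! ### The process killed at `(1,0)` and its contracting weight. -/

/-- The mean of `F` at the next state under local service, where the value of `F` at `(1, 0)` after
a completed service is replaced by `0`. -/
def killedMean (p : ℝ) (F : State → ℝ) (s : State) : ℝ :=
  p * (if s.service = 0 then 0 else F ⟨s.service.succPNat, 0⟩) +
    (1 - p) * F ⟨s.age + 1, s.service + 1⟩

/-- The Bellman operator of the process killed at `(1, 0)`, with the cost per slot reduced
by `g`. -/
def killedBellman (p lam g : ℝ) (F : State → ℝ) (s : State) : ℝ :=
  ((s.age : ℕ) : ℝ) + 1 / 2 - g + min lam (killedMean p F s)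

/-- A weight function for which the killed transitions contract by the factor `b`. -/
structure IsContractingWeight (p b : ℝ) (w : State → ℝ) : Prop where
  nonneg : 0 ≤ b
  lt_one : b < 1
  age_le : ∀ s, ((s.age : ℕ) : ℝ) ≤ w s
  killedMean_le : ∀ s, killedMean p w s ≤ b * w s

theorem exists_isContractingWeight {p : ℝ} (hp : 0 < p) (hp1 : p ≤ 1) :
    ∃ b w, IsContractingWeight p b w := by
  -- A completed service at `z > 0` loses `8 / p`, an expected drop of `8`; being killed at `z = 0`
  -- loses `22 / p ^ 2`, an expected drop of `22 / p`, which also pays for acquiring `8 / p`. The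
  -- factor `2` on `z` exceeds the factor `1` of the age, which restarts at `z + 1`, and so leaves a
  -- decrease proportional to `z`.
  refine ⟨1 - p ^ 2 / 22, fun s => ((s.age : ℕ) : ℝ) + 2 * s.service +
    (if s.service = 0 then 0 else 8 / p) + 22 / p ^ 2, by nlinarith, by nlinarith, ?_, ?_⟩
  · intro s
    have : (0 : ℝ) ≤ if s.service = 0 then 0 else 8 / p := by split_ifs <;> positivity
    have : 0 < 22 / p ^ 2 := by positivity
    have : (0 : ℝ) ≤ s.service := by positivity
    linarith
  · rintro ⟨a, z⟩
    have ha : (1 : ℝ) ≤ (a : ℕ) := Nat.one_le_cast.2 a.pos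
    have hz : (0 : ℝ) ≤ z := by positivity
    obtain ⟨q, hq⟩ : ∃ q, q = 1 / p := ⟨_, rfl⟩
    have hpq : p * q = 1 := by rw [hq]; field_simp
    have h8 : 8 / p = 8 * q := by rw [hq]; ring
    have h22 : 22 / p ^ 2 = 22 * q ^ 2 := by rw [hq]; field_simp
    have hq1 : 1 ≤ q := by nlinarith
    have hpp : p ^ 2 ≤ p := by nlinarith
    have hp2 : p ^ 2 * q ^ 2 = 1 := by rw [← mul_pow, hpq, one_pow]
    have hp2q : p ^ 2 * q = p := by rw [pow_two, mul_assoc, hpq, mul_one]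
    have hpq2 : p * q ^ 2 = q := by rw [pow_two, ← mul_assoc, hpq, one_mul]
    simp only [killedMean, h8, h22]
    by_cases hz0 : z = 0
    · subst hz0
      simp
      nlinarith
    · simp [hz0]
      nlinarith [mul_nonneg (sub_nonneg.2 hpp) hz]

/-! ### Value iteration for the killed process and the choice of `g`. -/

section Operator

variable {p b lam g g' : ℝ} {w F G : State → ℝ}

theorem abs_killedMean_sub_le (hp : 0 ≤ p) (hp1 : p ≤ 1) (hw : IsContractingWeight p b w) {K : ℝ}
    (hK : 0 ≤ K) (h : ∀ s, |F s - G s| ≤ K * w s) (s : State) :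
    |killedMean p F s - killedMean p G s| ≤ b * (K * w s) := by
  have h1 := h ⟨s.age + 1, s.service + 1⟩
  have h2 := h ⟨s.service.succPNat, 0⟩
  have h3 := mul_le_mul_of_nonneg_left (hw.killedMean_le s) hK
  rw [abs_le] at h1 h2 ⊢
  unfold killedMean at *
  have hq : 0 ≤ 1 - p := sub_nonneg.2 hp1
  split_ifs at * with hz
  · constructor <;> nlinarith [mul_le_mul_of_nonneg_left h1.1 hq, mul_le_mul_of_nonneg_left h1.2 hq]
  · constructor <;> nlinarith [mul_le_mul_of_nonneg_left h1.1 hq, mul_le_mul_of_nonneg_left h1.2 hq,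
      mul_le_mul_of_nonneg_left h2.1 hp, mul_le_mul_of_nonneg_left h2.2 hp]

theorem abs_killedBellman_sub_le (hp : 0 ≤ p) (hp1 : p ≤ 1) (hw : IsContractingWeight p b w)
    {K : ℝ} (hK : 0 ≤ K) (h : ∀ s, |F s - G s| ≤ K * w s) (s : State) :
    |killedBellman p lam g F s - killedBellman p lam g' G s| ≤ |g - g'| + b * (K * w s) := by
  have h1 := abs_killedMean_sub_le hp hp1 hw hK h s
  have h2 := abs_min_sub_min_le_max lam (killedMean p F s) lam (killedMean p G s)
  rw [sub_self, abs_zero, max_eq_right (abs_nonneg _)] at h2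
  calc _ = |(g' - g) + (min lam (killedMean p F s) - min lam (killedMean p G s))| := by
        unfold killedBellman; congr 1; ring
    _ ≤ |g' - g| + |min lam (killedMean p F s) - min lam (killedMean p G s)| := abs_add_le _ _
    _ ≤ _ := by rw [abs_sub_comm g' g]; linarith

theorem IsContractingWeight.one_le (hw : IsContractingWeight p b w) (s : State) : 1 ≤ w s :=
  (Nat.one_le_cast.2 s.age.pos).trans (hw.age_le s)

theorem killedBellman_mono_age (hp1 : p ≤ 1)
    (h : ∀ (a : ℕ+) (z : ℕ), F ⟨a, z⟩ ≤ F ⟨a + 1, z⟩) (a : ℕ+) (z : ℕ) :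
    killedMean p F ⟨a, z⟩ ≤ killedMean p F ⟨a + 1, z⟩ ∧
      killedBellman p lam g F ⟨a, z⟩ ≤ killedBellman p lam g F ⟨a + 1, z⟩ := by
  have h1 : killedMean p F ⟨a, z⟩ ≤ killedMean p F ⟨a + 1, z⟩ := by
    unfold killedMean
    have := mul_le_mul_of_nonneg_left (h (a + 1) (z + 1)) (sub_nonneg.2 hp1)
    linarith
  refine ⟨h1, ?_⟩
  unfold killedBellman
  have := min_le_min_left lam h1
  push_cast
  linarith

/-- The properties of the value function of the killed process that the average cost problem
uses. -/
structure IsKilledValue (p lam g : ℝ) (w V : State → ℝ) : Prop where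
  eq_killedBellman : ∀ s, V s = killedBellman p lam g V s
  exists_bound : ∃ K, ∀ s, |V s| ≤ K * w s
  mono_age : ∀ (a : ℕ+) (z : ℕ), V ⟨a, z⟩ ≤ V ⟨a + 1, z⟩
  nonneg : g ≤ 3 / 2 → ∀ s, 0 ≤ V s

/-- The first iterate is `age + 1/2 - g` because `min lam 0 = 0`, and `age ≤ w`, `1 ≤ w` bound it by
`(|g| + 2) * w`; each further step contracts by `b`. -/
theorem abs_iterate_succ_sub_le (hp : 0 ≤ p) (hp1 : p ≤ 1) (hlam : 0 ≤ lam)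
    (hw : IsContractingWeight p b w) (n : ℕ) (s : State) :
    |(killedBellman p lam g)^[n + 1] 0 s - (killedBellman p lam g)^[n] 0 s| ≤
      ((|g| + 2) * b ^ n) * w s := by
  induction n generalizing s with
  | zero =>
    have h1 := hw.age_le s
    have h2 := hw.one_le s
    have h3 : (0 : ℝ) ≤ (s.age : ℕ) := by positivity
    have h4 : |g| ≤ |g| * w s := le_mul_of_one_le_right (abs_nonneg _) h2
    have h5 : killedBellman p lam g 0 s = ((s.age : ℕ) : ℝ) + 1 / 2 - g := by
      simp [killedBellman, killedMean, hlam]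
    simp only [zero_add, Function.iterate_one, Function.iterate_zero, id, h5, Pi.zero_apply,
      sub_zero, pow_zero, mul_one]
    rw [abs_le]
    constructor <;> nlinarith [le_abs_self g, neg_abs_le g]
  | succ n ih =>
    have e := fun k => congrFun (Function.iterate_succ_apply' (killedBellman p lam g) k 0) s
    rw [e (n + 1), e n]
    have hb := hw.nonneg
    have h := abs_killedBellman_sub_le (lam := lam) (g := g) (g' := g) hp hp1 hw
      (by positivity) ih s
    rw [sub_self, abs_zero, zero_add] at h
    refine h.trans_eq ?_
    ring

/-- The value is built as the limit of the iterates from `0`, so that monotonicity, positivity and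
comparisons in `g` pass to it by induction on the iterates. -/
theorem exists_tendsto_iterate (hp : 0 ≤ p) (hp1 : p ≤ 1) (hlam : 0 ≤ lam)
    (hw : IsContractingWeight p b w) (g : ℝ) :
    ∃ V, IsKilledValue p lam g w V ∧
      ∀ s, Tendsto (fun n => (killedBellman p lam g)^[n] 0 s) atTop (nhds (V s)) := by
  have hdist : ∀ s n, dist ((killedBellman p lam g)^[n] 0 s) ((killedBellman p lam g)^[n + 1] 0 s) ≤
      ((|g| + 2) * w s) * b ^ n := fun s n => by
    rw [dist_comm, Real.dist_eq]
    exact (abs_iterate_succ_sub_le hp hp1 hlam hw n s).trans_eq (by ring)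
  choose V hV using fun s =>
    cauchySeq_tendsto_of_complete (cauchySeq_of_le_geometric b _ hw.lt_one (hdist s))
  refine ⟨V, ⟨fun s => ?_, ⟨(|g| + 2) / (1 - b), fun s => ?_⟩, fun a z => ?_, fun hg s => ?_⟩, hV⟩
  · have h1 := (tendsto_add_atTop_iff_nat 1).2 (hV s)
    simp only [Function.iterate_succ_apply'] at h1
    refine tendsto_nhds_unique h1 ?_
    unfold killedBellman killedMean
    refine tendsto_const_nhds.add (tendsto_const_nhds.min
      ((Tendsto.const_mul _ ?_).add ((hV _).const_mul _)))
    split_ifs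
    · exact tendsto_const_nhds
    · exact hV _
  · have h := dist_le_of_le_geometric_of_tendsto₀ b _ hw.lt_one (hdist s) (hV s)
    simp only [Function.iterate_zero, id, Pi.zero_apply, dist_zero_left, Real.norm_eq_abs] at h
    exact h.trans_eq (by ring)
  · refine le_of_tendsto_of_tendsto' (hV _) (hV _) fun n => ?_
    induction n generalizing a z with
    | zero => simp
    | succ n ih =>
      simp only [Function.iterate_succ_apply']
      exact (killedBellman_mono_age hp1 ih a z).2
  · refine ge_of_tendsto' (hV s) fun n => ?_
    induction n generalizing s with
    | zero => simp
    | succ n ih =>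
      simp only [Function.iterate_succ_apply']
      have ha : (1 : ℝ) ≤ (s.age : ℕ) := Nat.one_le_cast.2 s.age.pos
      have hq : 0 ≤ 1 - p := sub_nonneg.2 hp1
      have h1 : 0 ≤ killedMean p ((killedBellman p lam g)^[n] 0) s := by
        unfold killedMean
        have h2 := mul_nonneg hq (ih ⟨s.age + 1, s.service + 1⟩)
        have h3 := mul_nonneg hp (ih ⟨s.service.succPNat, 0⟩)
        split_ifs <;> linarith
      rw [killedBellman]
      have := le_min hlam h1
      linarith

/-- The constant `K = |g - g'| / (1 - b)` solves `|g - g'| + b * K = K`; since `1 ≤ w`, the bound `K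
* w` reproduces itself under iteration. -/
theorem abs_iterate_sub_le (hp : 0 ≤ p) (hp1 : p ≤ 1) (hw : IsContractingWeight p b w)
    (g g' : ℝ) (n : ℕ) (s : State) :
    |(killedBellman p lam g)^[n] 0 s - (killedBellman p lam g')^[n] 0 s| ≤
      |g - g'| / (1 - b) * w s := by
  have hb : 0 < 1 - b := sub_pos.2 hw.lt_one
  induction n generalizing s with
  | zero =>
    have := hw.one_le s
    simp only [Function.iterate_zero, id, Pi.zero_apply, sub_self, abs_zero]
    positivity
  | succ n ih =>
    rw [Function.iterate_succ_apply', Function.iterate_succ_apply']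
    refine (abs_killedBellman_sub_le hp hp1 hw (by positivity) ih s).trans ?_
    have h1 : |g - g'| = |g - g'| / (1 - b) * (1 - b) := by field_simp
    have h2 : |g - g'| ≤ |g - g'| / (1 - b) * (1 - b) * w s := by
      rw [← h1]
      exact le_mul_of_one_le_right (abs_nonneg _) (hw.one_le s)
    linarith

/-- For a suitable reduction `g` of the cost per slot, killing at `(1, 0)` does not change the
value. -/
theorem exists_isKilledValue_eq_zero (hp : 0 ≤ p) (hp1 : p ≤ 1) (hlam : 0 ≤ lam)
    (hw : IsContractingWeight p b w) :
    ∃ g V, IsKilledValue p lam g w V ∧ V ⟨1, 0⟩ = 0 := by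
  choose V hV hlim using exists_tendsto_iterate (lam := lam) hp hp1 hlam hw
  have hlip : ∀ g g', dist (V g ⟨1, 0⟩) (V g' ⟨1, 0⟩) ≤ w ⟨1, 0⟩ / (1 - b) * dist g g' :=
    fun g g' => by
      rw [Real.dist_eq, Real.dist_eq]
      refine (le_of_tendsto' ((hlim g ⟨1, 0⟩).sub (hlim g' ⟨1, 0⟩)).abs
        fun n => abs_iterate_sub_le hp hp1 hw g g' n _).trans_eq (by ring)
  have hcont : Continuous fun g => V g ⟨1, 0⟩ := by
    refine (LipschitzWith.of_dist_le_mul (K := (w ⟨1, 0⟩ / (1 - b)).toNNReal) fun g g' => ?_).continuous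
    refine (hlip g g').trans_eq ?_
    rw [Real.coe_toNNReal]
    exact div_nonneg (zero_le_one.trans (hw.one_le _)) (sub_pos.2 hw.lt_one).le
  have h0 : 0 ≤ V (3 / 2) ⟨1, 0⟩ := (hV _).nonneg le_rfl _
  -- At `(1,0)`, sending costs `1 + 1/2 + lam`, which this `g` cancels exactly.
  have h1 : V (3 / 2 + lam) ⟨1, 0⟩ ≤ 0 := by
    rw [(hV _).eq_killedBellman]
    unfold killedBellman
    have := min_le_left lam (killedMean p (V (3 / 2 + lam)) ⟨1, 0⟩)
    norm_num at this ⊢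
  obtain ⟨g, -, hg⟩ := intermediate_value_Icc' (by linarith : (3 / 2 : ℝ) ≤ 3 / 2 + lam)
    hcont.continuousOn ⟨h1, h0⟩
  exact ⟨g, V g, hV g, hg⟩

end Operator

/-! ### One-slot transitions and the marginal laws of the state. -/

/-- The mean of `F` at the next state. -/
def nextMean (p : ℝ) (F : State → ℝ) (s : State) : Action → ℝ
  | .mec => F ⟨1, 0⟩
  | .localServer => p * F ⟨s.service.succPNat, 0⟩ + (1 - p) * F ⟨s.age + 1, s.service + 1⟩

theorem integrable_transition (μ : unitInterval) (s : State) (u : Action) (F : State → ℝ) :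
    Integrable F (transition μ s u) := by
  cases u
  · exact integrable_dirac (by simp)
  · exact integrable_bernoulliMeasure _ _ _ _

theorem integral_transition (μ : unitInterval) (s : State) (u : Action) (F : State → ℝ) :
    ∫ t, F t ∂(transition μ s u) = nextMean μ F s u := by
  cases u
  · simp [transition, nextMean]
  · simp only [transition, nextMean, integral_bernoulliMeasure, smul_eq_mul]

/-- The transition kernel of one slot in which actions are chosen by `φ`. -/
def decisionKernel (μ : unitInterval) (φ : State → Action) : Kernel State State :=
  Kernel.ofFunOfCountable fun s => transition μ s (φ s)

theorem decisionKernel_apply (μ : unitInterval) (φ : State → Action) (s : State) :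
    decisionKernel μ φ s = transition μ s (φ s) := rfl

instance (μ : unitInterval) (φ : State → Action) : IsMarkovKernel (decisionKernel μ φ) :=
  ⟨fun s => inferInstanceAs (IsProbabilityMeasure (transition μ s (φ s)))⟩

/-- The law of the state in slot `n` under the policy `f`, given `S₀ = s`. -/
def stateLaw (μ : unitInterval) (f : Policy) (s : State) (n : ℕ) : Measure State :=
  (trajectoryLaw μ f s).map fun S => S n

instance (μ : unitInterval) (f : Policy) (s : State) :
    IsProbabilityMeasure (trajectoryLaw μ f s) := by
  unfold trajectoryLaw; infer_instance

instance (μ : unitInterval) (f : Policy) (s : State) (n : ℕ) :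
    IsProbabilityMeasure (stateLaw μ f s n) :=
  Measure.isProbabilityMeasure_map (measurable_pi_apply n).aemeasurable

theorem partialTraj_map_last (μ : unitInterval) (f : Policy) (s : State) (n : ℕ) :
    (Kernel.partialTraj (X := fun _ => State) (stepKernel μ f) 0 n (fun _ => s)).map
      (fun x => x ⟨n, Finset.mem_Iic.2 le_rfl⟩) = stateLaw μ f s n := by
  rw [← Kernel.traj_map_frestrictLe_apply, Measure.map_map (by fun_prop) (by fun_prop)]
  rfl

theorem stateLaw_zero (μ : unitInterval) (f : Policy) (s : State) :
    stateLaw μ f s 0 = Measure.dirac s := by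
  rw [← partialTraj_map_last, Kernel.partialTraj_self, Kernel.id_apply]
  exact Measure.map_dirac' (by fun_prop) _

/-- The trajectory measure gives the joint law of the past and the next state as a composition
product; its second marginal involves the past only through the last state. -/
theorem stateLaw_succ (μ : unitInterval) (f : Policy) (s : State) (n : ℕ) :
    stateLaw μ f s (n + 1) = decisionKernel μ (f n) ∘ₘ stateLaw μ f s n := by
  have h := congrArg Measure.snd (Kernel.partialTraj_compProd_eq_map_traj
    (X := fun _ => State) (κ := stepKernel μ f) (Nat.zero_le n) (x₀ := fun _ => s))
  rw [Measure.snd_compProd, Measure.snd, Measure.map_map (by fun_prop) (by fun_prop)] at h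
  refine Eq.trans h.symm ?_
  rw [← partialTraj_map_last]
  ext A hA
  rw [Measure.bind_apply hA (Kernel.aemeasurable _), Measure.bind_apply hA (Kernel.aemeasurable _),
    lintegral_map (Kernel.measurable_coe _ hA) (by fun_prop)]
  rfl

/-! ### Uniform moment bounds and telescoping of the optimality equation. -/

section Drift

variable {μ : unitInterval} {lam b g K : ℝ} {w F V : State → ℝ}

/-- Undoing the killing adds back at most `w (1,0)`, which turns the contraction into a geometric
drift condition valid for both actions. -/
theorem IsContractingWeight.nextMean_le (hw : IsContractingWeight μ b w) (s : State) (u : Action) :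
    nextMean μ w s u ≤ b * w s + w ⟨1, 0⟩ := by
  have h0 : 0 ≤ b * w s := mul_nonneg hw.nonneg (zero_le_one.trans (hw.one_le s))
  have h1 := hw.one_le ⟨1, 0⟩
  cases u
  · simpa [nextMean] using h0
  · have h2 := hw.killedMean_le s
    have h3 := mul_le_mul_of_nonneg_right μ.2.2 (zero_le_one.trans h1)
    unfold killedMean at h2
    unfold nextMean
    split_ifs at h2 with hz
    · rw [hz] at h2 ⊢
      change (μ : ℝ) * w ⟨1, 0⟩ + _ ≤ _
      linarith
    · linarith

theorem integrable_comp_decisionKernel {m : Measure State} [IsProbabilityMeasure m]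
    (hw : IsContractingWeight μ b w) (hm : Integrable w m) (φ : State → Action) :
    Integrable w (decisionKernel μ φ ∘ₘ m) := by
  have hF : Measurable w := measurable_from_top
  rw [Measure.integrable_comp_iff hF.aestronglyMeasurable]
  refine ⟨ae_of_all _ fun s => integrable_transition _ _ _ _, ?_⟩
  refine Integrable.mono' ((hm.const_mul b).add (integrable_const (w ⟨1, 0⟩)))
    Measurable.of_discrete.aestronglyMeasurable (ae_of_all _ fun s => ?_)
  rw [Real.norm_of_nonneg (integral_nonneg fun _ => norm_nonneg _)]
  have hn : (fun t => ‖w t‖) = w :=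
    funext fun t => Real.norm_of_nonneg (zero_le_one.trans (hw.one_le t))
  rw [hn, decisionKernel_apply, integral_transition]
  exact hw.nextMean_le s _

theorem integral_comp_decisionKernel {m : Measure State} [IsProbabilityMeasure m]
    (φ : State → Action) (hF : Integrable F (decisionKernel μ φ ∘ₘ m)) :
    ∫ t, F t ∂(decisionKernel μ φ ∘ₘ m) = ∫ s, nextMean μ F s (φ s) ∂m ∧
      Integrable (fun s => nextMean μ F s (φ s)) m := by
  simp only [← integral_transition, ← decisionKernel_apply]
  rw [Measure.comp_eq_comp_const_apply] at hF ⊢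
  refine ⟨(Kernel.integral_comp hF).trans (by rw [Kernel.const_apply]), ?_⟩
  have h := hF.integral_comp
  rwa [Kernel.const_apply] at h

theorem integrable_weight_stateLaw (hw : IsContractingWeight μ b w) (f : Policy) (s : State)
    (n : ℕ) : Integrable w (stateLaw μ f s n) := by
  induction n with
  | zero => rw [stateLaw_zero]; exact integrable_dirac (by simp)
  | succ n ih => rw [stateLaw_succ]; exact integrable_comp_decisionKernel hw ih _

/-- The drift recursion `x ↦ b * x + w (1,0)` has fixed point `w (1,0) / (1 - b)`, so the bound is
uniform in the slot and in the policy. -/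
theorem integral_weight_stateLaw_le (hw : IsContractingWeight μ b w) (f : Policy) (s : State)
    (n : ℕ) : ∫ t, w t ∂(stateLaw μ f s n) ≤ w s + w ⟨1, 0⟩ / (1 - b) := by
  have hb : 0 < 1 - b := sub_pos.2 hw.lt_one
  have h1 := zero_le_one.trans (hw.one_le ⟨1, 0⟩)
  have hs := zero_le_one.trans (hw.one_le s)
  induction n with
  | zero =>
    rw [stateLaw_zero, integral_dirac]
    have : 0 ≤ w ⟨1, 0⟩ / (1 - b) := by positivity
    linarith
  | succ n ih =>
    have hi := integrable_weight_stateLaw hw f s n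
    have hi' := integrable_weight_stateLaw hw f s (n + 1)
    rw [stateLaw_succ] at hi' ⊢
    obtain ⟨he, hn⟩ := integral_comp_decisionKernel (f n) hi'
    rw [he]
    have h2 : ∫ t, nextMean μ w t (f n t) ∂(stateLaw μ f s n) ≤
        ∫ t, (b * w t + w ⟨1, 0⟩) ∂(stateLaw μ f s n) :=
      integral_mono hn ((hi.const_mul b).add (integrable_const _)) fun t => hw.nextMean_le t _
    rw [integral_add (hi.const_mul b) (integrable_const _), integral_const_mul, integral_const,
      probReal_univ, one_smul] at h2
    have h3 := mul_le_mul_of_nonneg_left ih hw.nonneg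
    have h4 : w ⟨1, 0⟩ = (1 - b) * (w ⟨1, 0⟩ / (1 - b)) := by field_simp
    have h5 : b * w s ≤ w s := mul_le_of_le_one_left hs hw.lt_one.le
    linarith

theorem integrable_stateLaw (hw : IsContractingWeight μ b w) (hF : ∀ s, |F s| ≤ K * w s)
    (f : Policy) (s : State) (n : ℕ) : Integrable F (stateLaw μ f s n) :=
  ((integrable_weight_stateLaw hw f s n).const_mul K).mono'
    Measurable.of_discrete.aestronglyMeasurable (ae_of_all _ hF)

theorem abs_integral_stateLaw_le (hw : IsContractingWeight μ b w) (hF : ∀ s, |F s| ≤ K * w s)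
    (f : Policy) (s : State) (n : ℕ) :
    |∫ t, F t ∂(stateLaw μ f s n)| ≤ K * (w s + w ⟨1, 0⟩ / (1 - b)) := by
  have hK : 0 ≤ K := nonneg_of_mul_nonneg_left ((abs_nonneg _).trans (hF s))
    (zero_lt_one.trans_le (hw.one_le s))
  have h := norm_integral_le_of_norm_le ((integrable_weight_stateLaw hw f s n).const_mul K)
    (ae_of_all (stateLaw μ f s n) fun t => (Real.norm_eq_abs (F t)).trans_le (hF t))
  rw [integral_const_mul] at h
  exact h.trans (mul_le_mul_of_nonneg_left (integral_weight_stateLaw_le hw f s n) hK)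

theorem abs_cost_le (hw : IsContractingWeight μ b w) (lam : ℝ) (s : State) (u : Action) :
    |cost lam s u| ≤ (2 + |lam|) * w s := by
  have h1 := hw.age_le s
  have h2 := hw.one_le s
  have h3 : (0 : ℝ) ≤ (s.age : ℕ) := by positivity
  have h4 : |lam| ≤ |lam| * w s := le_mul_of_one_le_right (abs_nonneg _) h2
  rw [abs_le]
  cases u <;> simp only [cost, mecUse, mul_one, mul_zero] <;> constructor <;>
    nlinarith [le_abs_self lam, neg_abs_le lam, abs_nonneg lam]

/-- The expected cost in slot `n`. -/
def expectedCost (μ : unitInterval) (lam : ℝ) (f : Policy) (s : State) (n : ℕ) : ℝ :=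
  ∫ t, cost lam t (f n t) ∂(stateLaw μ f s n)

theorem expectedTotalCost_eq_sum (hw : IsContractingWeight μ b w) (f : Policy) (s : State)
    (N : ℕ) : expectedTotalCost μ lam f s N = ∑ n ∈ Finset.Icc 1 N, expectedCost μ lam f s n := by
  unfold expectedTotalCost
  rw [integral_finsetSum]
  · refine Finset.sum_congr rfl fun n _ => ?_
    rw [expectedCost, stateLaw, integral_map (measurable_pi_apply n).aemeasurable
      Measurable.of_discrete.aestronglyMeasurable]
  · intro n _
    exact (integrable_stateLaw hw (fun t => abs_cost_le hw lam t (f n t)) f s n).comp_measurable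
      (measurable_pi_apply n)

theorem integral_add_le_expectedCost (hw : IsContractingWeight μ b w) (hV : ∀ s, |V s| ≤ K * w s)
    (f : Policy) (s : State) (n : ℕ)
    (h : ∀ t, g + V t ≤ cost lam t (f n t) + nextMean μ V t (f n t)) :
    g + ∫ t, V t ∂(stateLaw μ f s n) ≤
      expectedCost μ lam f s n + ∫ t, V t ∂(stateLaw μ f s (n + 1)) := by
  have hi := integrable_stateLaw hw hV f s n
  have hi' := integrable_stateLaw hw hV f s (n + 1)
  have hc := integrable_stateLaw hw (fun t => abs_cost_le hw lam t (f n t)) f s n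
  rw [stateLaw_succ] at hi' ⊢
  obtain ⟨he, hn⟩ := integral_comp_decisionKernel (f n) hi'
  have h1 := integral_mono ((integrable_const g).add hi) (hc.add hn) h
  simp only [Pi.add_apply] at h1
  rwa [integral_add (integrable_const g) hi, integral_add hc hn, integral_const, probReal_univ,
    one_smul, ← he] at h1

theorem expectedCost_add_integral_eq (hw : IsContractingWeight μ b w) (hV : ∀ s, |V s| ≤ K * w s)
    (f : Policy) (s : State) (n : ℕ)
    (h : ∀ t, g + V t = cost lam t (f n t) + nextMean μ V t (f n t)) :
    expectedCost μ lam f s n + ∫ t, V t ∂(stateLaw μ f s (n + 1)) =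
      g + ∫ t, V t ∂(stateLaw μ f s n) := by
  have hi := integrable_stateLaw hw hV f s n
  have hi' := integrable_stateLaw hw hV f s (n + 1)
  have hc := integrable_stateLaw hw (fun t => abs_cost_le hw lam t (f n t)) f s n
  rw [stateLaw_succ] at hi' ⊢
  obtain ⟨he, hn⟩ := integral_comp_decisionKernel (f n) hi'
  rw [he, expectedCost, ← integral_add hc hn, ← integral_congr_ae (ae_of_all _ h),
    integral_add (integrable_const g) hi, integral_const, probReal_univ, one_smul]

theorem exists_le_expectedTotalCost (hw : IsContractingWeight μ b w)
    (hV : ∀ s, |V s| ≤ K * w s) (f : Policy) (s : State)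
    (h : ∀ n t, g + V t ≤ cost lam t (f n t) + nextMean μ V t (f n t)) :
    ∃ B, ∀ N : ℕ, N * g + B ≤ expectedTotalCost μ lam f s N := by
  -- Costs are counted from slot `1`, so the sum telescopes to the means of `V` in slots `1` and `N
  -- + 1`; each contributes one copy of the uniform bound.
  refine ⟨-(2 * (K * (w s + w ⟨1, 0⟩ / (1 - b)))), fun N => ?_⟩
  have key : N * g + ∫ t, V t ∂(stateLaw μ f s 1) ≤
      expectedTotalCost μ lam f s N + ∫ t, V t ∂(stateLaw μ f s (N + 1)) := by
    rw [expectedTotalCost_eq_sum hw]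
    induction N with
    | zero => simp
    | succ N ih =>
      rw [Finset.sum_Icc_succ_top (by omega)]
      have := integral_add_le_expectedCost hw hV f s (N + 1) (h _)
      push_cast
      linarith
  have h1 := abs_le.1 (abs_integral_stateLaw_le hw hV f s 1)
  have h2 := abs_le.1 (abs_integral_stateLaw_le hw hV f s (N + 1))
  linarith

theorem exists_expectedTotalCost_le (hw : IsContractingWeight μ b w)
    (hV : ∀ s, |V s| ≤ K * w s) (f : Policy) (s : State)
    (h : ∀ n t, g + V t = cost lam t (f n t) + nextMean μ V t (f n t)) :
    ∃ B, ∀ N : ℕ, expectedTotalCost μ lam f s N ≤ N * g + B := by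
  refine ⟨2 * (K * (w s + w ⟨1, 0⟩ / (1 - b))), fun N => ?_⟩
  have key : expectedTotalCost μ lam f s N + ∫ t, V t ∂(stateLaw μ f s (N + 1)) =
      N * g + ∫ t, V t ∂(stateLaw μ f s 1) := by
    rw [expectedTotalCost_eq_sum hw]
    induction N with
    | zero => simp
    | succ N ih =>
      rw [Finset.sum_Icc_succ_top (by omega)]
      have := expectedCost_add_integral_eq hw hV f s (N + 1) (h _)
      push_cast
      linarith
  have h1 := abs_le.1 (abs_integral_stateLaw_le hw hV f s 1)
  have h2 := abs_le.1 (abs_integral_stateLaw_le hw hV f s (N + 1))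
  linarith

end Drift

/-! ### From total costs to long-run averages. -/

theorem tendsto_average_affine (g B : ℝ) :
    Tendsto (fun N : ℕ => ((1 / (N : ℝ) * (N * g + B) : ℝ) : EReal)) atTop (nhds (g : EReal)) := by
  refine (continuous_coe_real_ereal.tendsto g).comp ?_
  have h : Tendsto (fun N : ℕ => g + B / (N : ℝ)) atTop (nhds (g + 0)) :=
    tendsto_const_nhds.add (tendsto_const_div_atTop_nhds_zero_nat B)
  rw [add_zero] at h
  refine h.congr' ?_
  filter_upwards [eventually_ge_atTop 1] with N hN
  have : (N : ℝ) ≠ 0 := by positivity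
  field_simp

variable {μ : unitInterval} {lam g B : ℝ} {f : Policy} {s : State}

theorem averageCost_le (h : ∀ N : ℕ, expectedTotalCost μ lam f s N ≤ N * g + B) :
    averageCost μ lam f s ≤ g := by
  rw [← (tendsto_average_affine g B).limsup_eq]
  refine limsup_le_limsup (Eventually.of_forall fun N => ?_)
  exact EReal.coe_le_coe_iff.2 (mul_le_mul_of_nonneg_left (h N) (by positivity))

theorem le_averageCost (h : ∀ N : ℕ, N * g + B ≤ expectedTotalCost μ lam f s N) :
    g ≤ averageCost μ lam f s := by
  rw [← (tendsto_average_affine g B).limsup_eq]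
  refine limsup_le_limsup (Eventually.of_forall fun N => ?_)
  exact EReal.coe_le_coe_iff.2 (mul_le_mul_of_nonneg_left (h N) (by positivity))

/-! ### The optimality equation and the greedy threshold policy. -/

section Optimality

variable {w V : State → ℝ}

/-- The killed and true means can differ only when service completes at `z = 0`, where the next
state is `(1,0)` and `V` vanishes. -/
theorem nextMean_localServer_eq_killedMean {p : ℝ} (h0 : V ⟨1, 0⟩ = 0) (s : State) :
    nextMean p V s .localServer = killedMean p V s := by
  unfold nextMean killedMean
  split_ifs with hz
  · rw [hz, show V ⟨Nat.succPNat 0, 0⟩ = 0 from h0]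
  · rfl

theorem IsKilledValue.add_le (hV : IsKilledValue μ lam g w V) (h0 : V ⟨1, 0⟩ = 0) (s : State)
    (u : Action) : g + V s ≤ cost lam s u + nextMean μ V s u := by
  rw [hV.eq_killedBellman, killedBellman]
  cases u
  · have := min_le_left lam (killedMean μ V s)
    simp only [cost, mecUse, nextMean, h0]
    linarith
  · have := min_le_right lam (killedMean μ V s)
    rw [nextMean_localServer_eq_killedMean h0]
    simp only [cost, mecUse]
    linarith

open Classical in
/-- The decision rule that is greedy with respect to `V`. -/
def greedy (p lam : ℝ) (V : State → ℝ) (s : State) : Action :=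
  if lam ≤ killedMean p V s then .mec else .localServer

theorem IsKilledValue.add_eq_greedy (hV : IsKilledValue μ lam g w V) (h0 : V ⟨1, 0⟩ = 0)
    (s : State) :
    g + V s = cost lam s (greedy μ lam V s) + nextMean μ V s (greedy μ lam V s) := by
  rw [hV.eq_killedBellman, killedBellman, greedy]
  split_ifs with h
  · simp only [cost, mecUse, nextMean, h0, min_eq_left h]
    ring
  · rw [nextMean_localServer_eq_killedMean h0, min_eq_right (not_le.1 h).le]
    simp only [cost, mecUse]
    ring

/-- Sending costs `lam` whatever the age, while the continuation mean is nondecreasing in the age;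
the inequality defining the greedy choice therefore persists. -/
theorem isAgeThreshold_greedy {p : ℝ} (hp1 : p ≤ 1)
    (hV : ∀ (a : ℕ+) (z : ℕ), V ⟨a, z⟩ ≤ V ⟨a + 1, z⟩) :
    IsAgeThreshold fun _ => greedy p lam V := by
  refine ⟨⟨_, fun _ => rfl⟩, fun _ a z h => ?_⟩
  have h1 : lam ≤ killedMean p V ⟨a, z⟩ := by
    by_contra hc
    simp [greedy, hc] at h
  exact if_pos (h1.trans (killedBellman_mono_age (lam := lam) (g := 0) hp1 hV a z).1)

end Optimality

end MECOffloading

end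

theorem theorem1 (μ : unitInterval) (hμ : 0 < μ) (lam : ℝ) (hlam : 0 < lam) :
    ∃ f : MECOffloading.Policy,
      MECOffloading.IsAgeThreshold f ∧ MECOffloading.IsAverageOptimal μ lam f := by
  obtain ⟨b, w, hw⟩ := MECOffloading.exists_isContractingWeight (p := μ) hμ μ.2.2
  obtain ⟨g, V, hV, h0⟩ :=
    MECOffloading.exists_isKilledValue_eq_zero μ.2.1 μ.2.2 hlam.le hw
  obtain ⟨K, hK⟩ := hV.exists_bound
  refine ⟨fun _ => MECOffloading.greedy μ lam V,
    MECOffloading.isAgeThreshold_greedy μ.2.2 hV.mono_age, fun f s => ?_⟩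
  obtain ⟨B, hB⟩ := MECOffloading.exists_expectedTotalCost_le hw hK
    (fun _ => MECOffloading.greedy μ lam V) s fun _ t => hV.add_eq_greedy h0 t
  obtain ⟨B', hB'⟩ := MECOffloading.exists_le_expectedTotalCost hw hK f s
    fun n t => hV.add_le h0 t (f n t)
  exact (MECOffloading.averageCost_le hB).trans (MECOffloading.le_averageCost hB')
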